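/- Let $\mathcal M=\langle \mathcal S,\mathcal A,\mathbf P,\mathcal R,\ell,\mathbf{AP},s_I\rangle$ be a Markov decision process (standard Borel state and action spaces, measurable data) with rewards in $[-\frac12,\frac12]$, let $\overline{\mathcal M}=\langle \overline{\mathcal S},\overline{\mathcal A},\overline{\mathbf P},\overline{\mathcal R},\overline\ell,\mathbf{AP},\bar s_I\rangle$ be a discrete latent MDP ($\overline{\mathcal S}$ countable, with the discrete metric $1_{\neq}$), and let $\phi:\mathcal S\to\overline{\mathcal S}$, $\psi:\mathcal S\times\overline{\mathcal A}\to\mathcal A$ be measurable embedding functions such that $\ell(s)=\overline\ell(\phi(s))$ for all $s$ and $\psi(s,\cdot)$ maps actions enabled in $\phi(s)$ to actions enabled in $s$. Let $\gamma\in[0,1)$ and let $\bar\pi$ be a memoryless policy of $\overline{\mathcal M}$, also executed in $\mathcal M$ by drawing $\bar a\sim\bar\pi(\cdot\mid\phi(s))$ and playing $\psi(s,\bar a)$; write $\mathbf P_{\bar\pi},\mathcal R_{\bar\pi}$ (resp. $\overline{\mathbf P}_{\bar\pi},\overline{\mathcal R}_{\bar\pi}$) for the transition and reward functions of the Markov chain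 so induced in $\mathcal M$ (resp. $\overline{\mathcal M}$). Let $W_d$ be the Wasserstein distance for the (pseudo)metric $d$, and let $K_{\mathcal R},K_{\mathbf P}\ge 0$ with $\gamma K_{\mathbf P}<1$ be such that for all $\bar s_1,\bar s_2\in\overline{\mathcal S}$ $$|\overline{\mathcal R}_{\bar\pi}(\bar s_1)-\overline{\mathcal R}_{\bar\pi}(\bar s_2)|\le K_{\mathcal R}1_{\neq}(\bar s_1,\bar s_2),\qquad W_{1_{\neq}}\big(\overline{\mathbf P}_{\bar\pi}(\cdot\mid\bar s_1),\overline{\mathbf P}_{\bar\pi}(\cdot\mid\bar s_2)\big)\le K_{\mathbf P}1_{\neq}(\bar s_1,\bar s_2).$$ Let $\xi_{\bar\pi}$ be a stationary distribution of the Markov chain induced by $\bar\pi$ in $\mathcal M$, and put $$L_{\mathcal R}=\mathbb E_{s\sim\xi_{\bar\pi},\,\bar a\sim\bar\pi(\cdot\mid\phi(s))}\big|\mathcal R(s,\psi(s,\bar a))-\overline{\mathcal R}(\phi(s),\bar a)\big|,$$ $$L_{\mathbf P}=\mathbb E_{s\sim\xi_{\bar\pi},\,\bar a\sim\bar\pi(\cdot\mid\phi(s))}W_{1_{\neq}}\big(\phi\mathbf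 P(\cdot\mid s,\psi(s,\bar a)),\overline{\mathbf P}(\cdot\mid\phi(s),\bar a)\big),$$ where $\phi\mathbf P(\cdot\mid s,a)$ is the image of $\mathbf P(\cdot\mid s,a)$ under $\phi$. For $\varphi\in\{\mathcal R,\ell\}$ let $\tilde d^{\varphi}_{\bar\pi}$ be the bisimulation pseudometric on $\mathcal S$, that is, the unique bounded fixed point of $$\Delta(d)(s_1,s_2)=(1-\gamma)\,|\mathcal R_{\bar\pi}(s_1)-\mathcal R_{\bar\pi}(s_2)|\,1_{\{\mathcal R\}}(\varphi)+\max\Big\{\gamma W_d\big(\mathbf P_{\bar\pi}(\cdot\mid s_1),\mathbf P_{\bar\pi}(\cdot\mid s_2)\big),\ 1_{\neq}(\ell(s_1),\ell(s_2))\,1_{\{\ell\}}(\varphi)\Big\}.$$ Let $s_1,s_2\in\mathcal S$ with $\phi(s_1)=\phi(s_2)$. Suppose that $\mathcal M$ is ergodic (under every memoryless policy, the whole state space is an aperiodic bottom strongly connected component whose stationary distribution is the limit of the $t$-step distributions from every state), or, without ergodicity, just that $\xi_{\bar\pi}(\{s_1\})>0$ and $\xi_{\bar\pi}(\{s_2\})>0$.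 Then, with $\xi_{\bar\pi}^{-1}(s)=1/\xi_{\bar\pi}(\{s\})$, $$\tilde d^{\mathcal R}_{\bar\pi}(s_1,s_2)\le\Big[L_{\mathcal R}+\frac{\gamma L_{\mathbf P}K_{\mathcal R}}{1-\gamma K_{\mathbf P}}\Big]\big(\xi_{\bar\pi}^{-1}(s_1)+\xi_{\bar\pi}^{-1}(s_2)\big),$$ $$\tilde d^{\ell}_{\bar\pi}(s_1,s_2)\le\frac{\gamma L_{\mathbf P}}{1-\gamma}\big(\xi_{\bar\pi}^{-1}(s_1)+\xi_{\bar\pi}^{-1}(s_2)\big).$$ -/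

import Mathlib

open MeasureTheory ProbabilityTheory Filter
open scoped ENNReal Topology

/-! ### Wasserstein distances -/

section Wasserstein

variable {X : Type*} [MeasurableSpace X]

/-- The couplings of `P` and `Q`: measures on `X × X` with marginals `P` and `Q`. -/
def couplings (P Q : Measure X) : Set (Measure (X × X)) :=
  {lam | lam.fst = P ∧ lam.snd = Q}

/-- The (upper) expectation of a cost `d` under `lam`. It is the Lebesgue integral of `d` when `d` is
measurable; in general it is the least integral of a measurable majorant, so that the
Wasserstein distance makes sense for every pseudometric. -/
noncomputable def expectedCost (d : X → X → ℝ≥0∞) (lam : Measure (X × X)) : ℝ≥0∞ :=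
  ⨅ g ∈ {g : X × X → ℝ≥0∞ | Measurable g ∧ ∀ p, d p.1 p.2 ≤ g p}, ∫⁻ p, g p ∂lam

theorem expectedCost_eq_lintegral {d : X → X → ℝ≥0∞} (hd : Measurable fun p : X × X => d p.1 p.2)
    (lam : Measure (X × X)) : expectedCost d lam = ∫⁻ p, d p.1 p.2 ∂lam :=
  le_antisymm (iInf₂_le_of_le (fun p : X × X => d p.1 p.2) ⟨hd, fun _ => le_rfl⟩ le_rfl)
    (le_iInf₂ fun _ hg => lintegral_mono hg.2)

/-- The Wasserstein distance between `P` and `Q` for the (pseudo)metric `d` on `X`. -/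
noncomputable def wasserstein (d : X → X → ℝ≥0∞) (P Q : Measure X) : ℝ≥0∞ :=
  ⨅ lam ∈ couplings P Q, expectedCost d lam

theorem expectedCost_mono {d d' : X → X → ℝ≥0∞} (h : d ≤ d') (lam : Measure (X × X)) :
    expectedCost d lam ≤ expectedCost d' lam :=
  le_iInf₂ fun g hg => iInf₂_le g ⟨hg.1, fun p => (h p.1 p.2).trans (hg.2 p)⟩

theorem wasserstein_mono {d d' : X → X → ℝ≥0∞} (h : d ≤ d') (P Q : Measure X) :
    wasserstein d P Q ≤ wasserstein d' P Q :=
  iInf₂_mono fun lam _ => expectedCost_mono h lam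

open Classical in
/-- The discrete metric `1_{≠}`. -/
noncomputable def discreteDist {Y : Type*} (x y : Y) : ℝ≥0∞ := if x = y then 0 else 1

end Wasserstein

/-! ### Markov decision processes -/

/-- A Markov decision process with state space `S`, action space `A` and atomic propositions `AP`. -/
structure MDP (S A AP : Type*) [MeasurableSpace S] [MeasurableSpace A] where
  /-- the probability transition function `P(· | s, a)` -/
  trans : Kernel (S × A) S
  isMarkov : IsMarkovKernel trans
  /-- the reward function -/
  reward : S × A → ℝ
  measurable_reward : Measurable reward
  /-- the labeling function -/
  label : S → Set AP
  measurableSet_label : ∀ T : Set AP, MeasurableSet (label ⁻¹' {T})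
  /-- the initial state -/
  init : S
  /-- the set of enabled actions of a state -/
  enabled : S → Set A
  enabled_nonempty : ∀ s, (enabled s).Nonempty
  measurableSet_enabled : ∀ s, MeasurableSet (enabled s)

namespace MDP

variable {S A AP : Type*} [MeasurableSpace S] [MeasurableSpace A]

/-- Memoryless policies: stochastic maps from states to actions, choosing enabled actions only. -/
def IsPolicy (M : MDP S A AP) (pol : Kernel S A) : Prop :=
  IsMarkovKernel pol ∧ ∀ s, ∀ᵐ a ∂(pol s), a ∈ M.enabled s

/-- The transition distribution `P_π(· | s)` of the Markov chain induced by the policy `π`. -/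
noncomputable def chain (M : MDP S A AP) (pol : Kernel S A) : Kernel S S :=
  M.trans ∘ₖ (Kernel.id ×ₖ pol)

/-- The reward function `R_π(s)` of the Markov chain induced by the policy `π`. -/
noncomputable def policyReward (M : MDP S A AP) (pol : Kernel S A) (s : S) : ℝ :=
  ∫ a, M.reward (s, a) ∂(pol s)

/-- `M` is ergodic: under every memoryless policy the whole state space is one aperiodic bottom
strongly connected component, whose stationary distribution is the limit of the `t`-step
distributions from every state. -/
def IsErgodic (M : MDP S A AP) : Prop :=
  ∀ pol : Kernel S A, M.IsPolicy pol →
    (∀ s s' : S, ∃ t : ℕ, ((M.chain pol) ^ t) s {s'} ≠ 0) ∧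
    (∀ (s : S) (k : ℕ), (∀ t : ℕ, 0 < t → ((M.chain pol) ^ t) s {s} ≠ 0 → k ∣ t) → k = 1) ∧
    ∃ ξ : Measure S, IsProbabilityMeasure ξ ∧ (M.chain pol).Invariant ξ ∧
      ∀ (s : S) (B : Set S), MeasurableSet B →
        Tendsto (fun t : ℕ => ((M.chain pol) ^ t) s B) atTop (𝓝 (ξ B))

end MDP

/-! ### Bisimulation pseudometrics -/

/-- The two kinds of bisimulation pseudometrics: reward-based and label-based. -/
inductive BisimKind
  | reward
  | label

namespace MDP

variable {S A AP : Type*} [MeasurableSpace S] [MeasurableSpace A]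

/-- The reward part `(1 - γ) |R_π(s₁) - R_π(s₂)| · 1_{φ = R}` of the operator `Δ`. -/
noncomputable def rewardTerm (M : MDP S A AP) (pol : Kernel S A) (γ : ℝ) (s₁ s₂ : S) :
    BisimKind → ℝ≥0∞
  | .reward => ENNReal.ofReal ((1 - γ) * |M.policyReward pol s₁ - M.policyReward pol s₂|)
  | .label => 0

/-- The label part `1_{≠}(ℓ(s₁), ℓ(s₂)) · 1_{φ = ℓ}` of the operator `Δ`. -/
noncomputable def labelTerm (M : MDP S A AP) (s₁ s₂ : S) : BisimKind → ℝ≥0∞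
  | .reward => 0
  | .label => discreteDist (M.label s₁) (M.label s₂)

/-- The operator `Δ` whose fixed point is the bisimulation pseudometric of the given kind. -/
noncomputable def bisimOp (M : MDP S A AP) (pol : Kernel S A) (γ : ℝ) (k : BisimKind) :
    (S → S → ℝ≥0∞) →o (S → S → ℝ≥0∞) where
  toFun d s₁ s₂ := M.rewardTerm pol γ s₁ s₂ k +
    max (ENNReal.ofReal γ * wasserstein d (M.chain pol s₁) (M.chain pol s₂)) (M.labelTerm s₁ s₂ k)
  monotone' _ _ h _ _ := by
    dsimp only
    gcongr
    exact wasserstein_mono h _ _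

/-- The bisimulation pseudometric: the fixed point of `Δ`. It is taken as the least one, and is
the only bounded one when `0 ≤ γ < 1` and the rewards lie in `[-1/2, 1/2]`
(see `bisimDist_unique`). -/
noncomputable def bisimDist (M : MDP S A AP) (pol : Kernel S A) (γ : ℝ) (k : BisimKind) :
    S → S → ℝ≥0∞ :=
  (M.bisimOp pol γ k).lfp

end MDP

/-! ### Latent space models -/

/-- A latent space model `⟨M', φ, ψ⟩` of the MDP `M`; `ψ` embeds enabled actions of `φ s` as
enabled actions of `s`. -/
structure LatentSpaceModel {S A AP : Type*} [MeasurableSpace S] [MeasurableSpace A]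
    (M : MDP S A AP) (S' A' : Type*) [MeasurableSpace S'] [MeasurableSpace A'] where
  /-- the latent MDP -/
  latent : MDP S' A' AP
  /-- the state embedding function -/
  φ : S → S'
  measurable_φ : Measurable φ
  /-- the action embedding function -/
  ψ : S × A' → A
  measurable_ψ : Measurable ψ
  enabled_ψ : ∀ s, ∀ a ∈ latent.enabled (φ s), ψ (s, a) ∈ M.enabled s

namespace LatentSpaceModel

variable {S A AP : Type*} [MeasurableSpace S] [MeasurableSpace A] {M : MDP S A AP}
  {S' A' : Type*} [MeasurableSpace S'] [MeasurableSpace A']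

/-- The latent policy reading original states: `π(· | s) = π(· | φ(s))`, on latent actions. -/
noncomputable def embeddedPolicy (L : LatentSpaceModel M S' A') (pol : Kernel S' A') :
    Kernel S A' :=
  pol.comap L.φ L.measurable_φ

/-- The latent policy as a policy of the original MDP: embed the state with `φ`, draw a latent
action, embed it with `ψ`. -/
noncomputable def liftPolicy (L : LatentSpaceModel M S' A') (pol : Kernel S' A') : Kernel S A :=
  (Kernel.id ×ₖ L.embeddedPolicy pol).map L.ψ

/-- The latent MDP is `⟨K_R, K_P⟩`-Lipschitz under the latent policy, for the metric `d` on latent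
states. -/
def IsLipschitz (L : LatentSpaceModel M S' A') (d : S' → S' → ℝ≥0∞) (pol : Kernel S' A')
    (KR KP : ℝ) : Prop :=
  ∀ z₁ z₂ : S',
    ENNReal.ofReal |L.latent.policyReward pol z₁ - L.latent.policyReward pol z₂|
        ≤ ENNReal.ofReal KR * d z₁ z₂ ∧
    wasserstein d (L.latent.chain pol z₁) (L.latent.chain pol z₂) ≤ ENNReal.ofReal KP * d z₁ z₂

/-- The local reward loss for a distribution `μ` on original states and latent actions. -/
noncomputable def localRewardLoss (L : LatentSpaceModel M S' A') (μ : Measure (S × A')) : ℝ≥0∞ :=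
  ∫⁻ x, ENNReal.ofReal |M.reward (x.1, L.ψ x) - L.latent.reward (L.φ x.1, x.2)| ∂μ

/-- The local transition loss for a distribution `μ` on original states and latent actions, and
the metric `d` on latent states. -/
noncomputable def localTransitionLoss (L : LatentSpaceModel M S' A') (d : S' → S' → ℝ≥0∞)
    (μ : Measure (S × A')) : ℝ≥0∞ :=
  ∫⁻ x, wasserstein d ((M.trans (x.1, L.ψ x)).map L.φ) (L.latent.trans (L.φ x.1, x.2)) ∂μ

/-- The distribution of `(s, a)` where `s ∼ ξ` and then `a` is drawn from the latent policy. -/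
noncomputable def stateAction (L : LatentSpaceModel M S' A') (pol : Kernel S' A')
    (ξ : Measure S) : Measure (S × A') :=
  ξ ⊗ₘ L.embeddedPolicy pol

end LatentSpaceModel

/-! ### The bisimulation pseudometric is the unique bounded fixed point -/

theorem wasserstein_le_add_const {X : Type*} [MeasurableSpace X] {d d' : X → X → ℝ≥0∞} {c : ℝ≥0∞}
    (h : ∀ x y, d x y ≤ d' x y + c) (P Q : Measure X) [IsProbabilityMeasure P] :
    wasserstein d P Q ≤ wasserstein d' P Q + c := by
  rw [wasserstein, wasserstein, ENNReal.iInf_add]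
  refine le_iInf fun lam => ?_
  rw [ENNReal.iInf_add]
  refine le_iInf fun hlam => iInf₂_le_of_le lam hlam ?_
  have h1 : lam Set.univ = 1 := by
    have := congrArg (fun m : Measure X => m Set.univ) hlam.1
    simpa [Measure.fst_univ] using this
  rw [expectedCost, expectedCost, ENNReal.iInf_add]
  refine le_iInf fun g => ?_
  rw [ENNReal.iInf_add]
  refine le_iInf fun hg => iInf₂_le_of_le (fun p => g p + c)
    ⟨hg.1.add_const c, fun p => (h p.1 p.2).trans (add_le_add_left (hg.2 p) c)⟩ ?_
  rw [lintegral_add_right _ measurable_const, lintegral_const, h1, mul_one]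

theorem wasserstein_le_of_le_const {X : Type*} [MeasurableSpace X] {d : X → X → ℝ≥0∞} {c : ℝ≥0∞}
    (h : ∀ x y, d x y ≤ c) (P Q : Measure X) [IsProbabilityMeasure P] [IsProbabilityMeasure Q] :
    wasserstein d P Q ≤ c := by
  refine iInf₂_le_of_le (P.prod Q) ⟨by simp, by simp⟩ ?_
  refine iInf₂_le_of_le (fun _ => c) ⟨measurable_const, fun p => h p.1 p.2⟩ ?_
  simp

namespace MDP

variable {S A AP : Type*} [MeasurableSpace S] [MeasurableSpace A]

theorem isMarkovKernel_chain (M : MDP S A AP) (pol : Kernel S A) (hpol : IsMarkovKernel pol) :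
    IsMarkovKernel (M.chain pol) := by
  have := M.isMarkov
  unfold chain
  infer_instance

theorem bisimOp_bisimDist (M : MDP S A AP) (pol : Kernel S A) (γ : ℝ) (k : BisimKind) :
    M.bisimOp pol γ k (M.bisimDist pol γ k) = M.bisimDist pol γ k :=
  OrderHom.map_lfp _

theorem bisimDist_le_one (M : MDP S A AP) (pol : Kernel S A) (hpol : IsMarkovKernel pol)
    (hR : ∀ s a, M.reward (s, a) ∈ Set.Icc (-(1 / 2) : ℝ) (1 / 2)) (γ : ℝ) (h0 : 0 ≤ γ)
    (h1 : γ < 1) (k : BisimKind) (s₁ s₂ : S) : M.bisimDist pol γ k s₁ s₂ ≤ 1 := by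
  have hch := M.isMarkovKernel_chain pol hpol
  refine OrderHom.lfp_le (f := M.bisimOp pol γ k) (a := fun _ _ => 1) ?_ s₁ s₂
  intro s t
  have hW : wasserstein (fun _ _ => 1) (M.chain pol s) (M.chain pol t) ≤ 1 :=
    wasserstein_le_of_le_const (fun _ _ => le_rfl) _ _
  have hγ : ENNReal.ofReal γ * wasserstein (fun _ _ => 1) (M.chain pol s) (M.chain pol t)
      ≤ ENNReal.ofReal γ := mul_le_of_le_one_right' hW
  have hP : ∀ s, |M.policyReward pol s| ≤ 1 / 2 := fun s => by
    have := norm_integral_le_of_norm_le_const (μ := pol s) (f := fun a => M.reward (s, a))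
      (C := 1 / 2) (ae_of_all _ fun a => abs_le.2 (hR s a))
    simpa [policyReward] using this
  cases k with
  | reward =>
    change ENNReal.ofReal _ + max _ 0 ≤ 1
    have habs : |M.policyReward pol s - M.policyReward pol t| ≤ 1 :=
      (abs_sub _ _).trans (by linarith [hP s, hP t])
    calc _ ≤ ENNReal.ofReal (1 - γ) + ENNReal.ofReal γ := by
          gcongr
          · nlinarith
          · exact max_le hγ zero_le
      _ = 1 := by rw [← ENNReal.ofReal_add (by linarith) h0]; simp
  | label =>
    change 0 + max _ (discreteDist _ _) ≤ 1
    rw [zero_add]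
    refine max_le (hγ.trans (by simpa using h1.le)) ?_
    unfold discreteDist
    split_ifs <;> simp

theorem bisimDist_unique (M : MDP S A AP) (pol : Kernel S A) (hpol : IsMarkovKernel pol)
    (γ : ℝ) (h1 : γ < 1) (k : BisimKind) (d : S → S → ℝ≥0∞) (C : ℝ≥0∞) (hC : C ≠ ∞)
    (hd : ∀ s t, d s t ≤ C) (hfix : M.bisimOp pol γ k d = d) : d = M.bisimDist pol γ k := by
  have hch := M.isMarkovKernel_chain pol hpol
  refine le_antisymm ?_ (OrderHom.lfp_le_fixed _ hfix)
  have key : ∀ n : ℕ, ∀ s t, d s t ≤ M.bisimDist pol γ k s t + ENNReal.ofReal γ ^ n * C := by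
    intro n
    induction n with
    | zero => intro s t; simpa using (hd s t).trans le_add_self
    | succ n ih =>
      intro s t
      rw [← hfix, ← bisimOp_bisimDist]
      change M.rewardTerm pol γ s t k + max (ENNReal.ofReal γ * wasserstein d (M.chain pol s)
          (M.chain pol t)) (M.labelTerm s t k) ≤ (M.rewardTerm pol γ s t k +
        max (ENNReal.ofReal γ * wasserstein (M.bisimDist pol γ k) (M.chain pol s)
          (M.chain pol t)) (M.labelTerm s t k)) + _
      rw [add_assoc]
      gcongr
      refine max_le ?_ ((le_max_right _ _).trans le_self_add)
      calc _ ≤ ENNReal.ofReal γ * (wasserstein (M.bisimDist pol γ k) (M.chain pol s)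
              (M.chain pol t) + ENNReal.ofReal γ ^ n * C) := by
            gcongr
            exact wasserstein_le_add_const ih _ _
        _ = ENNReal.ofReal γ * wasserstein (M.bisimDist pol γ k) (M.chain pol s)
              (M.chain pol t) + ENNReal.ofReal γ ^ (n + 1) * C := by ring
        _ ≤ _ := by gcongr; exact le_max_left _ _
  intro s t
  have hlim : Tendsto (fun n : ℕ => M.bisimDist pol γ k s t + ENNReal.ofReal γ ^ n * C) atTop
      (𝓝 (M.bisimDist pol γ k s t + 0 * C)) :=
    tendsto_const_nhds.add (ENNReal.Tendsto.mul_const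
      (ENNReal.tendsto_pow_atTop_nhds_zero_of_lt_one (by simpa using h1)) (Or.inr hC))
  simpa using ge_of_tendsto' hlim fun n => key n s t

end MDP

/-! The bisimulation pseudometric is a least fixed point, so any `D` with `Δ D ≤ D` dominates it
(Knaster–Tarski). The supersolution used is `D s t = f s + f t + c * discreteDist (φ s) (φ t)`. Here
`f` is the expected discounted sum, along the chain in `M`, of a local cost `g`: a reward error `ρ`
plus `γ * c` times the transition error, in total variation.

To bound the Wasserstein distance for `D`, take a maximal coupling of the images under `φ` of the
two transition laws and lift it to the original states. The terms in `f` depend only on the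
marginals, and the discrete term costs `c` times the total variation of the images
(`wasserstein_le_lintegral_add_totalVariation`). Passing through the latent laws bounds that total
variation by two transition errors plus the latent total variation. The errors are absorbed by `f =
g + γ P f`; the latent term is absorbed by the choice of `c` (`bisimDist_le_discountedSum`).

If `φ s₁ = φ s₂`, only `f s₁ + f s₂` remains. Stationarity gives `∫ f dξ = (1 - γ)⁻¹ ∫ g dξ`, and a
nonnegative function at an atom is at most its integral divided by the mass of the atom. -/

/-! ### Total variation on a countable space -/

section TotalVariation

variable {Z : Type*} [MeasurableSpace Z]

/-- The total variation distance of two probability measures on a countable space. -/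
noncomputable def totalVariation (P Q : Measure Z) : ℝ≥0∞ := ∑' z, (P {z} - Q {z})

@[simp]
theorem totalVariation_self (P : Measure Z) : totalVariation P P = 0 := by
  simp [totalVariation]

theorem totalVariation_triangle (P Q R : Measure Z) :
    totalVariation P R ≤ totalVariation P Q + totalVariation Q R := by
  rw [totalVariation, totalVariation, totalVariation, ← ENNReal.tsum_add]
  exact ENNReal.tsum_le_tsum fun z => tsub_le_tsub_add_tsub

variable [Countable Z] [DiscreteMeasurableSpace Z]

theorem tsum_measure_singleton (P : Measure Z) : ∑' z, P {z} = P Set.univ := by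
  rw [← lintegral_one, lintegral_countable']
  simp

theorem totalVariation_le_one (P Q : Measure Z) [IsProbabilityMeasure P] :
    totalVariation P Q ≤ 1 :=
  calc totalVariation P Q ≤ ∑' z, P {z} := ENNReal.tsum_le_tsum fun z => tsub_le_self
    _ = 1 := by rw [tsum_measure_singleton, measure_univ]

/-- Adding the common total mass 1 turns the truncated differences into `max (P {z}) (Q {z})`, which
is symmetric. -/
theorem totalVariation_comm (P Q : Measure Z) [IsProbabilityMeasure P] [IsProbabilityMeasure Q] :
    totalVariation P Q = totalVariation Q P := by
  have h : totalVariation P Q + 1 = totalVariation Q P + 1 := by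
    calc totalVariation P Q + 1 = ∑' z, (P {z} - Q {z} + Q {z}) := by
          rw [ENNReal.tsum_add, tsum_measure_singleton, measure_univ, totalVariation]
      _ = ∑' z, (Q {z} - P {z} + P {z}) := by simp only [tsub_add_eq_max, max_comm]
      _ = totalVariation Q P + 1 := by
          rw [ENNReal.tsum_add, tsum_measure_singleton, measure_univ, totalVariation]
  exact (ENNReal.add_left_inj ENNReal.one_ne_top).1 h

/-- In any coupling, the excess of the first marginal at `z` must sit on off-diagonal pairs with
first coordinate `z`; these sets are disjoint for distinct `z`. -/
theorem totalVariation_le_wasserstein (P Q : Measure Z) :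
    totalVariation P Q ≤ wasserstein discreteDist P Q := by
  refine le_iInf₂ fun lam hlam => ?_
  obtain ⟨rfl, rfl⟩ := hlam
  have hne : ∀ p : Z × Z, discreteDist p.1 p.2 = ({p | p.1 ≠ p.2} : Set (Z × Z)).indicator 1 p := by
    intro p
    by_cases h : p.1 = p.2 <;> simp [discreteDist, h]
  rw [expectedCost_eq_lintegral Measurable.of_discrete, lintegral_congr hne,
    lintegral_indicator_one (MeasurableSet.of_discrete)]
  have hle : ∀ z, lam.fst {z} - lam.snd {z} ≤ lam (Prod.fst ⁻¹' {z} ∩ {p | p.1 ≠ p.2}) := by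
    intro z
    rw [Measure.fst_apply (measurableSet_singleton z), Measure.snd_apply (measurableSet_singleton z),
      tsub_le_iff_right]
    refine (measure_mono ?_).trans (measure_union_le _ _)
    rintro ⟨x, y⟩ (rfl : x = z)
    by_cases h : x = y <;> simp [h]
  calc totalVariation lam.fst lam.snd
      ≤ ∑' z, lam (Prod.fst ⁻¹' {z} ∩ {p | p.1 ≠ p.2}) := ENNReal.tsum_le_tsum hle
    _ = lam (⋃ z, Prod.fst ⁻¹' {z} ∩ {p | p.1 ≠ p.2}) := by
        refine (measure_iUnion ?_ fun _ => MeasurableSet.of_discrete).symm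
        intro z w hzw
        refine Set.disjoint_left.2 fun p hp hp' => hzw ?_
        exact hp.1.symm.trans hp'.1
    _ ≤ lam {p | p.1 ≠ p.2} := measure_mono (Set.iUnion_subset fun z => Set.inter_subset_right)

open Classical in
/-- The mass of a maximal coupling of `P` and `Q` at a pair of points. -/
noncomputable def maximalCoupling (P Q : Measure Z) (z w : Z) : ℝ≥0∞ :=
  (if z = w then min (P {z}) (Q {z}) else 0) +
    (totalVariation P Q)⁻¹ * ((P {z} - Q {z}) * (Q {w} - P {w}))

theorem maximalCoupling_comm (P Q : Measure Z) [IsProbabilityMeasure P] [IsProbabilityMeasure Q]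
    (z w : Z) : maximalCoupling P Q z w = maximalCoupling Q P w z := by
  unfold maximalCoupling
  rw [totalVariation_comm P Q, mul_comm (P {z} - Q {z})]
  by_cases h : z = w
  · subst h; simp [min_comm]
  · simp [h, Ne.symm h]

/-- The common mass stays on the diagonal, and the surplus of `P` at `z` is spread proportionally
over the deficits, whose total is again the total variation. -/
theorem tsum_maximalCoupling (P Q : Measure Z) [IsProbabilityMeasure P] [IsProbabilityMeasure Q]
    (z : Z) : ∑' w, maximalCoupling P Q z w = P {z} := by
  classical
  unfold maximalCoupling
  rw [ENNReal.tsum_add, ENNReal.tsum_mul_left, ENNReal.tsum_mul_left,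
    ← totalVariation, ← totalVariation_comm P Q]
  have h1 : ∑' w, (if z = w then min (P {z}) (Q {z}) else 0) = min (P {z}) (Q {z}) := by
    rw [tsum_eq_single z fun w hw => by simp [hw.symm]]
    simp
  have h2 : (totalVariation P Q)⁻¹ * ((P {z} - Q {z}) * totalVariation P Q) = P {z} - Q {z} := by
    by_cases h0 : totalVariation P Q = 0
    -- Here the inverse is `∞`, but it multiplies a surplus equal to zero.
    · have := ENNReal.tsum_eq_zero.1 h0 z
      simp [this]
    · rw [mul_comm, mul_assoc, ENNReal.mul_inv_cancel h0
        (ne_top_of_le_ne_top ENNReal.one_ne_top (totalVariation_le_one P Q)), mul_one]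
  rw [h1, h2, add_comm]
  rcases le_total (P {z}) (Q {z}) with h | h
  · rw [min_eq_left h, tsub_eq_zero_of_le h, zero_add]
  · rw [min_eq_right h, tsub_add_cancel_of_le h]

theorem tsum_maximalCoupling' (P Q : Measure Z) [IsProbabilityMeasure P] [IsProbabilityMeasure Q]
    (w : Z) : ∑' z, maximalCoupling P Q z w = Q {w} := by
  simp_rw [maximalCoupling_comm P Q]
  exact tsum_maximalCoupling Q P w

theorem tsum_discreteDist_mul_maximalCoupling_le (P Q : Measure Z) [IsProbabilityMeasure P]
    [IsProbabilityMeasure Q] :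
    ∑' z, ∑' w, discreteDist z w * maximalCoupling P Q z w ≤ totalVariation P Q := by
  classical
  have h : ∀ z w, discreteDist z w * maximalCoupling P Q z w ≤
      (totalVariation P Q)⁻¹ * ((P {z} - Q {z}) * (Q {w} - P {w})) := by
    intro z w
    by_cases h : z = w <;> simp [discreteDist, maximalCoupling, h]
  refine (ENNReal.tsum_le_tsum fun z => ENNReal.tsum_le_tsum (h z)).trans ?_
  simp_rw [ENNReal.tsum_mul_left, ENNReal.tsum_mul_right]
  rw [← totalVariation, ← totalVariation, ← totalVariation_comm P Q, ← mul_assoc]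
  exact mul_le_of_le_one_left' (ENNReal.inv_mul_le_one _)

/-- Joint convexity: averaging two kernels over the same law can only cancel surpluses. It passes
from state-action errors to errors of the induced chains. -/
theorem totalVariation_lintegral_le {X : Type*} [MeasurableSpace X] (μ : Measure X)
    (P Q : Kernel X Z) :
    ∑' z, ((∫⁻ x, P x {z} ∂μ) - ∫⁻ x, Q x {z} ∂μ) ≤ ∫⁻ x, totalVariation (P x) (Q x) ∂μ := by
  unfold totalVariation
  have hP := fun z : Z => P.measurable_coe (measurableSet_singleton z)
  have hQ := fun z : Z => Q.measurable_coe (measurableSet_singleton z)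
  rw [lintegral_tsum (f := fun z x => P x {z} - Q x {z}) fun z => ((hP z).sub (hQ z)).aemeasurable]
  exact ENNReal.tsum_le_tsum fun z => lintegral_sub_le' _ _ (hQ z).aemeasurable

theorem measurable_totalVariation {X : Type*} [MeasurableSpace X] (P Q : Kernel X Z) :
    Measurable fun x => totalVariation (P x) (Q x) :=
  Measurable.tsum fun z => (P.measurable_coe (measurableSet_singleton z)).sub
    (Q.measurable_coe (measurableSet_singleton z))

end TotalVariation

/-! ### Lifting couplings along a map to a countable space -/

section Lift

variable {S Z : Type*} [MeasurableSpace S] [MeasurableSpace Z] [Countable Z]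

/-- There are countably many fibres, so the union of the null ones is null. -/
theorem ae_measure_map_singleton_ne_zero (P : Measure S) {φ : S → Z} (hφ : Measurable φ) :
    ∀ᵐ x ∂P, P.map φ {φ x} ≠ 0 := by
  have h : ∀ᵐ z ∂(P.map φ), P.map φ {z} ≠ 0 := by
    rw [ae_iff_of_countable]
    exact fun z hz => hz
  exact ae_of_ae_map hφ.aemeasurable h

variable [DiscreteMeasurableSpace Z]

/-- Draw a pair of fibres from the maximal coupling of the images, then draw the two points
independently from `P` and `Q` conditioned on these fibres. As a density with respect to `P.prod Q`,
this needs no disintegration. -/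
theorem wasserstein_le_lintegral_add_totalVariation (P Q : Measure S) [IsProbabilityMeasure P]
    [IsProbabilityMeasure Q] {φ : S → Z} (hφ : Measurable φ) {f : S → ℝ≥0∞} (hf : Measurable f)
    (c : ℝ≥0∞) :
    wasserstein (fun x y => f x + f y + c * discreteDist (φ x) (φ y)) P Q ≤
      ∫⁻ x, f x ∂P + ∫⁻ y, f y ∂Q + c * totalVariation (P.map φ) (Q.map φ) := by
  have hP' : IsProbabilityMeasure (P.map φ) := Measure.isProbabilityMeasure_map hφ.aemeasurable
  have hQ' : IsProbabilityMeasure (Q.map φ) := Measure.isProbabilityMeasure_map hφ.aemeasurable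
  set p : Z → ℝ≥0∞ := fun z => P.map φ {z} with hp
  set q : Z → ℝ≥0∞ := fun z => Q.map φ {z} with hq
  set m : Z → Z → ℝ≥0∞ := maximalCoupling (P.map φ) (Q.map φ) with hm
  have hm1 : ∀ z, ∑' w, m z w = p z := tsum_maximalCoupling _ _
  have hm2 : ∀ w, ∑' z, m z w = q w := tsum_maximalCoupling' _ _
  have hmp : ∀ z w, m z w ≤ p z := fun z w => (ENNReal.le_tsum w).trans (hm1 z).le
  have hmq : ∀ z w, m z w ≤ q w := fun z w => (ENNReal.le_tsum z).trans (hm2 w).le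
  -- The density of the lifted coupling. Null fibres are harmless: `m` is at most `p` and `q`, so it
  -- vanishes there and the quotient is `0`.
  set k : Z → Z → ℝ≥0∞ := fun z w => m z w / p z / q w with hk
  have hkq : ∀ z w, k z w * q w = m z w / p z := by
    intro z w
    by_cases h0 : q w = 0
    · have : m z w = 0 := le_antisymm ((hmq z w).trans h0.le) zero_le
      simp [h0, this]
    · exact ENNReal.div_mul_cancel h0 (measure_ne_top _ _)
  have hkpq : ∀ z w, k z w * q w * p z = m z w := by
    intro z w
    rw [hkq]
    by_cases h0 : p z = 0
    · have : m z w = 0 := le_antisymm ((hmp z w).trans h0.le) zero_le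
      simp [h0, this]
    · exact ENNReal.div_mul_cancel h0 (measure_ne_top _ _)
  have hkp : ∀ z w, k z w * p z = m z w / q w := by
    intro z w
    by_cases h0 : q w = 0
    · have : m z w = 0 := le_antisymm ((hmq z w).trans h0.le) zero_le
      simp [hk, this]
    · rw [ENNReal.eq_div_iff h0 (measure_ne_top _ _), ← hkpq z w]
      ring
  have hkm : Measurable fun x : S × S => k (φ x.1) (φ x.2) :=
    (Measurable.of_discrete (f := fun z : Z × Z => k z.1 z.2)).comp
      ((hφ.comp measurable_fst).prodMk (hφ.comp measurable_snd))
  have hQint : ∀ g : Z → ℝ≥0∞, ∫⁻ y, g (φ y) ∂Q = ∑' w, g w * q w := fun g => by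
    rw [← lintegral_map (μ := Q) (f := g) Measurable.of_discrete hφ, lintegral_countable']
  have hPint : ∀ g : Z → ℝ≥0∞, ∫⁻ y, g (φ y) ∂P = ∑' w, g w * p w := fun g => by
    rw [← lintegral_map (μ := P) (f := g) Measurable.of_discrete hφ, lintegral_countable']
  have hfib : ∀ᵐ x ∂P, ∫⁻ y, k (φ x) (φ y) ∂Q = 1 := by
    filter_upwards [ae_measure_map_singleton_ne_zero P hφ] with x hx
    rw [hQint]
    simp_rw [hkq, div_eq_mul_inv]
    rw [ENNReal.tsum_mul_right, hm1]
    exact ENNReal.mul_inv_cancel hx (measure_ne_top _ _)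
  have hfib' : ∀ᵐ y ∂Q, ∫⁻ x, k (φ x) (φ y) ∂P = 1 := by
    filter_upwards [ae_measure_map_singleton_ne_zero Q hφ] with y hy
    rw [hPint fun z => k z (φ y)]
    simp_rw [hkp, div_eq_mul_inv]
    rw [ENNReal.tsum_mul_right, hm2]
    exact ENNReal.mul_inv_cancel hy (measure_ne_top _ _)
  set lam : Measure (S × S) := (P.prod Q).withDensity fun x => k (φ x.1) (φ x.2) with hlam
  have hint : ∀ g : S × S → ℝ≥0∞, Measurable g →
      ∫⁻ x, g x ∂lam = ∫⁻ x, ∫⁻ y, k (φ x) (φ y) * g (x, y) ∂Q ∂P := by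
    intro g hg
    rw [hlam, lintegral_withDensity_eq_lintegral_mul _ hkm hg,
      lintegral_prod _ (hkm.mul hg).aemeasurable]
    rfl
  have hint' : ∀ g : S × S → ℝ≥0∞, Measurable g →
      ∫⁻ x, g x ∂lam = ∫⁻ y, ∫⁻ x, k (φ x) (φ y) * g (x, y) ∂P ∂Q := by
    intro g hg
    rw [hlam, lintegral_withDensity_eq_lintegral_mul _ hkm hg,
      lintegral_prod_symm _ (hkm.mul hg).aemeasurable]
    rfl
  have hfst : ∀ g : S → ℝ≥0∞, Measurable g → ∫⁻ x, g x.1 ∂lam = ∫⁻ x, g x ∂P := by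
    intro g hg
    rw [hint (fun x => g x.1) (hg.comp measurable_fst)]
    refine lintegral_congr_ae ?_
    filter_upwards [hfib] with x hx
    rw [lintegral_mul_const (g x) (f := fun y => k (φ x) (φ y))
      (hkm.comp measurable_prodMk_left), hx, one_mul]
  have hsnd : ∀ g : S → ℝ≥0∞, Measurable g → ∫⁻ x, g x.2 ∂lam = ∫⁻ x, g x ∂Q := by
    intro g hg
    rw [hint' (fun x => g x.2) (hg.comp measurable_snd)]
    refine lintegral_congr_ae ?_
    filter_upwards [hfib'] with y hy
    rw [lintegral_mul_const (g y) (f := fun x => k (φ x) (φ y))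
      (hkm.comp measurable_prodMk_right), hy, one_mul]
  have hcoup : lam ∈ couplings P Q := by
    constructor
    · refine Measure.ext_of_lintegral _ fun g hg => ?_
      rw [Measure.fst, lintegral_map hg measurable_fst, hfst g hg]
    · refine Measure.ext_of_lintegral _ fun g hg => ?_
      rw [Measure.snd, lintegral_map hg measurable_snd, hsnd g hg]
  have hdm : Measurable fun x : S × S => discreteDist (φ x.1) (φ x.2) :=
    (Measurable.of_discrete (f := fun z : Z × Z => discreteDist z.1 z.2)).comp
      ((hφ.comp measurable_fst).prodMk (hφ.comp measurable_snd))
  have hdist : ∫⁻ x, discreteDist (φ x.1) (φ x.2) ∂lam ≤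
      totalVariation (P.map φ) (Q.map φ) := by
    rw [hint _ hdm]
    simp only
    simp_rw [fun x => hQint fun w => k (φ x) w * discreteDist (φ x) w]
    rw [hPint fun z => ∑' w, k z w * discreteDist z w * q w]
    refine le_trans (le_of_eq ?_) (tsum_discreteDist_mul_maximalCoupling_le (P.map φ) (Q.map φ))
    refine tsum_congr fun z => ?_
    rw [← ENNReal.tsum_mul_right]
    refine tsum_congr fun w => ?_
    rw [← hm, ← hkpq z w]
    ring
  have hf1 : Measurable fun x : S × S => f x.1 := hf.comp measurable_fst
  have hf2 : Measurable fun x : S × S => f x.2 := hf.comp measurable_snd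
  refine iInf₂_le_of_le lam hcoup ?_
  rw [expectedCost_eq_lintegral ((hf1.add hf2).add (hdm.const_mul c)),
    lintegral_add_left (f := fun x : S × S => f x.1 + f x.2) (hf1.add hf2),
    lintegral_add_left hf1, hfst f hf, hsnd f hf,
    lintegral_const_mul _ hdm]
  gcongr

end Lift

/-! ### Discounted sums along a Markov chain -/

section Discounted

variable {S : Type*} [MeasurableSpace S]

/-- The expected discounted sum of the costs `g` along the chain with kernel `κ`. -/
noncomputable def discountedSum (κ : Kernel S S) (γ : ℝ≥0∞) (g : S → ℝ≥0∞) (s : S) : ℝ≥0∞ :=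
  ∑' n : ℕ, γ ^ n * ((fun (h : S → ℝ≥0∞) s => ∫⁻ t, h t ∂(κ s))^[n] g) s

theorem measurable_iterate_lintegral (κ : Kernel S S) {g : S → ℝ≥0∞} (hg : Measurable g) (n : ℕ) :
    Measurable ((fun (h : S → ℝ≥0∞) s => ∫⁻ t, h t ∂(κ s))^[n] g) := by
  induction n with
  | zero => exact hg
  | succ n ih =>
    rw [Function.iterate_succ_apply']
    exact ih.lintegral_kernel

theorem measurable_discountedSum (κ : Kernel S S) (γ : ℝ≥0∞) {g : S → ℝ≥0∞} (hg : Measurable g) :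
    Measurable (discountedSum κ γ g) :=
  Measurable.tsum fun n => (measurable_iterate_lintegral κ hg n).const_mul _

/-- First-step decomposition: split off the term `n = 0` and shift the index. -/
theorem discountedSum_eq (κ : Kernel S S) (γ : ℝ≥0∞) {g : S → ℝ≥0∞} (hg : Measurable g) (s : S) :
    discountedSum κ γ g s = g s + γ * ∫⁻ t, discountedSum κ γ g t ∂(κ s) := by
  unfold discountedSum
  rw [tsum_eq_zero_add' ENNReal.summable,
    lintegral_tsum fun n => ((measurable_iterate_lintegral κ hg n).const_mul _).aemeasurable,
    ← ENNReal.tsum_mul_left]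
  congr 1
  · simp
  · refine tsum_congr fun n => ?_
    rw [lintegral_const_mul _ (measurable_iterate_lintegral κ hg n), Function.iterate_succ_apply',
      _root_.pow_succ', mul_assoc]

/-- By invariance every iterate of `g` has the same integral under `ξ`, leaving a geometric series.
-/
theorem lintegral_discountedSum (κ : Kernel S S) (γ : ℝ≥0∞) {g : S → ℝ≥0∞} (hg : Measurable g)
    {ξ : Measure S} (hξ : κ.Invariant ξ) :
    ∫⁻ s, discountedSum κ γ g s ∂ξ = (1 - γ)⁻¹ * ∫⁻ s, g s ∂ξ := by
  have h : ∀ n : ℕ, ∫⁻ s, ((fun (h : S → ℝ≥0∞) s => ∫⁻ t, h t ∂(κ s))^[n] g) s ∂ξ =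
      ∫⁻ s, g s ∂ξ := by
    intro n
    induction n with
    | zero => rfl
    | succ n ih =>
      rw [Function.iterate_succ_apply', ← Measure.lintegral_bind κ.aemeasurable
        (measurable_iterate_lintegral κ hg n).aemeasurable, hξ.def, ih]
  unfold discountedSum
  rw [lintegral_tsum fun n => ((measurable_iterate_lintegral κ hg n).const_mul _).aemeasurable]
  simp_rw [lintegral_const_mul _ (measurable_iterate_lintegral κ hg _), h]
  rw [ENNReal.tsum_mul_right, ENNReal.tsum_geometric]

theorem le_lintegral_mul_inv_measure_singleton [MeasurableSingletonClass S] (ξ : Measure S)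
    [IsFiniteMeasure ξ] (f : S → ℝ≥0∞) {s : S} (hs : ξ {s} ≠ 0) :
    f s ≤ (∫⁻ t, f t ∂ξ) * (ξ {s})⁻¹ := by
  rw [← div_eq_mul_inv, ENNReal.le_div_iff_mul_le (Or.inl hs) (Or.inl (measure_ne_top _ _)),
    ← lintegral_singleton]
  exact setLIntegral_le_lintegral _ _

theorem invariant_pow {κ : Kernel S S} {ξ : Measure S} (hξ : κ.Invariant ξ) (n : ℕ) :
    (κ ^ n).Invariant ξ := by
  induction n with
  | zero => exact Measure.bind_dirac
  | succ n ih => exact ih.comp hξ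

/-- If `s` were null, invariance under each power of `κ` would make almost every `t` miss `s` at
time `n`. There are countably many times, so some `t` would never reach `s`. -/
theorem measure_singleton_ne_zero_of_reachable [MeasurableSingletonClass S] {κ : Kernel S S}
    {ξ : Measure S} [NeZero ξ] (hξ : κ.Invariant ξ) {s : S} (h : ∀ t, ∃ n : ℕ, (κ ^ n) t {s} ≠ 0) :
    ξ {s} ≠ 0 := by
  intro h0
  have hn : ∀ n : ℕ, ∀ᵐ t ∂ξ, (κ ^ n) t {s} = 0 := by
    intro n
    have := (invariant_pow hξ n).def
    rw [← this, Measure.bind_apply (measurableSet_singleton s) (κ ^ n).aemeasurable,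
      lintegral_eq_zero_iff ((κ ^ n).measurable_coe (measurableSet_singleton s))] at h0
    exact h0
  obtain ⟨t, ht⟩ := (ae_all_iff.2 hn).exists
  obtain ⟨n, hn'⟩ := h t
  exact hn' (ht n)

end Discounted

/-! ### Induced chains, lifted policies and local errors -/

namespace MDP

variable {S A AP : Type*} [MeasurableSpace S] [MeasurableSpace A]

theorem chain_apply (M : MDP S A AP) (pol : Kernel S A) [IsMarkovKernel pol] (s : S) {B : Set S}
    (hB : MeasurableSet B) : M.chain pol s B = ∫⁻ a, M.trans (s, a) B ∂(pol s) := by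
  rw [chain, Kernel.comp_apply' _ _ _ hB, Kernel.prod_apply, Kernel.id_apply, Measure.dirac_prod,
    lintegral_map (M.trans.measurable_coe hB) measurable_prodMk_left]

end MDP

namespace LatentSpaceModel

variable {S A AP : Type*} [MeasurableSpace S] [MeasurableSpace A] {M : MDP S A AP}
  {S' A' : Type*} [MeasurableSpace S'] [MeasurableSpace A'] (L : LatentSpaceModel M S' A')
  (pol : Kernel S' A')

theorem isMarkovKernel_embeddedPolicy [IsMarkovKernel pol] :
    IsMarkovKernel (L.embeddedPolicy pol) := by
  unfold embeddedPolicy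
  infer_instance

theorem isMarkovKernel_liftPolicy [IsMarkovKernel pol] : IsMarkovKernel (L.liftPolicy pol) := by
  have := L.isMarkovKernel_embeddedPolicy pol
  exact Kernel.IsMarkovKernel.map _ L.measurable_ψ

theorem measurable_ψ_right (s : S) : Measurable fun a => L.ψ (s, a) :=
  L.measurable_ψ.comp measurable_prodMk_left

theorem liftPolicy_apply [IsMarkovKernel pol] (s : S) :
    L.liftPolicy pol s = (pol (L.φ s)).map fun a => L.ψ (s, a) := by
  have := L.isMarkovKernel_embeddedPolicy pol
  rw [liftPolicy, Kernel.map_apply _ L.measurable_ψ, Kernel.prod_apply, Kernel.id_apply,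
    Measure.dirac_prod, Measure.map_map L.measurable_ψ measurable_prodMk_left]
  rfl

theorem isPolicy_liftPolicy (hpol : L.latent.IsPolicy pol) : M.IsPolicy (L.liftPolicy pol) := by
  have := hpol.1
  refine ⟨L.isMarkovKernel_liftPolicy pol, fun s => ?_⟩
  rw [liftPolicy_apply]
  refine (ae_map_iff (p := (· ∈ M.enabled s)) (L.measurable_ψ_right s).aemeasurable
    (M.measurableSet_enabled s)).2 ?_
  filter_upwards [hpol.2 (L.φ s)] with a ha
  exact L.enabled_ψ s a ha

theorem chain_liftPolicy_apply [IsMarkovKernel pol] (s : S) {B : Set S} (hB : MeasurableSet B) :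
    M.chain (L.liftPolicy pol) s B = ∫⁻ a, M.trans (s, L.ψ (s, a)) B ∂(pol (L.φ s)) := by
  have := L.isMarkovKernel_liftPolicy pol
  rw [M.chain_apply _ s hB, liftPolicy_apply, lintegral_map
    (f := fun a => M.trans (s, a) B) ((M.trans.measurable_coe hB).comp measurable_prodMk_left)
    (L.measurable_ψ_right s)]

theorem policyReward_liftPolicy [IsMarkovKernel pol] (s : S) :
    M.policyReward (L.liftPolicy pol) s = ∫ a, M.reward (s, L.ψ (s, a)) ∂(pol (L.φ s)) := by
  rw [MDP.policyReward, liftPolicy_apply, integral_map (f := fun a => M.reward (s, a))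
    (L.measurable_ψ_right s).aemeasurable
    (M.measurable_reward.comp measurable_prodMk_left).aestronglyMeasurable]

/-- The pointwise error of the latent reward function. -/
noncomputable def rewardError (x : S × A') : ℝ≥0∞ :=
  ENNReal.ofReal |M.reward (x.1, L.ψ x) - L.latent.reward (L.φ x.1, x.2)|

/-- The pointwise error of the latent transition function, in total variation. -/
noncomputable def transitionError (x : S × A') : ℝ≥0∞ :=
  totalVariation ((M.trans (x.1, L.ψ x)).map L.φ) (L.latent.trans (L.φ x.1, x.2))

theorem measurable_rewardError : Measurable L.rewardError := by
  have h1 : Measurable fun x : S × A' => M.reward (x.1, L.ψ x) :=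
    M.measurable_reward.comp (measurable_fst.prodMk L.measurable_ψ)
  have h2 : Measurable fun x : S × A' => L.latent.reward (L.φ x.1, x.2) :=
    L.latent.measurable_reward.comp ((L.measurable_φ.comp measurable_fst).prodMk measurable_snd)
  exact (h1.sub h2).abs.ennreal_ofReal

theorem lintegral_stateAction [IsMarkovKernel pol] (ξ : Measure S) [SFinite ξ]
    {h : S × A' → ℝ≥0∞} (hh : Measurable h) :
    ∫⁻ s, ∫⁻ a, h (s, a) ∂(pol (L.φ s)) ∂ξ = ∫⁻ x, h x ∂(L.stateAction pol ξ) := by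
  have := L.isMarkovKernel_embeddedPolicy pol
  rw [stateAction, Measure.lintegral_compProd hh]
  rfl

theorem measurable_lintegral_policy [IsMarkovKernel pol] {h : S × A' → ℝ≥0∞} (hh : Measurable h) :
    Measurable fun s => ∫⁻ a, h (s, a) ∂(pol (L.φ s)) := by
  have := L.isMarkovKernel_embeddedPolicy pol
  exact hh.lintegral_kernel_prod_right' (κ := L.embeddedPolicy pol)

theorem ofReal_abs_policyReward_sub_le [IsMarkovKernel pol] {C : ℝ}
    (hM : ∀ s a, |M.reward (s, a)| ≤ C) (s : S) :
    ENNReal.ofReal |M.policyReward (L.liftPolicy pol) s - L.latent.policyReward pol (L.φ s)| ≤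
      ∫⁻ a, L.rewardError (s, a) ∂(pol (L.φ s)) := by
  have hi : Integrable (fun a => M.reward (s, L.ψ (s, a))) (pol (L.φ s)) :=
    Integrable.of_bound (M.measurable_reward.comp (measurable_const.prodMk
      (L.measurable_ψ_right s))).aestronglyMeasurable C
      (ae_of_all _ fun a => hM _ _)
  have hm : Measurable fun a => L.latent.reward (L.φ s, a) :=
    L.latent.measurable_reward.comp measurable_prodMk_left
  rw [policyReward_liftPolicy, MDP.policyReward]
  by_cases hi' : Integrable (fun a => L.latent.reward (L.φ s, a)) (pol (L.φ s))
  · rw [← integral_sub hi hi', ← Real.enorm_eq_ofReal_abs]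
    refine (enorm_integral_le_lintegral_enorm _).trans (le_of_eq ?_)
    simp_rw [Real.enorm_eq_ofReal_abs]
    rfl
  -- The latent rewards are not assumed bounded. If they are not integrable, their Bochner integral
  -- defaults to `0`, but the error then has infinite integral, since the original rewards are
  -- integrable.
  · have htop : ∫⁻ a, L.rewardError (s, a) ∂(pol (L.φ s)) = ∞ := by
      by_contra h
      have hd : Integrable (fun a => M.reward (s, L.ψ (s, a)) - L.latent.reward (L.φ s, a))
          (pol (L.φ s)) := by
        refine ⟨hi.1.sub hm.aestronglyMeasurable, ?_⟩
        simp_rw [HasFiniteIntegral, Real.enorm_eq_ofReal_abs]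
        exact lt_top_iff_ne_top.2 h
      refine hi' ((hi.sub hd).congr (ae_of_all _ fun a => ?_))
      simp
    rw [htop]
    exact le_top

/-! ### Transition errors and a supersolution for the bisimulation operator -/

variable [Countable S'] [DiscreteMeasurableSpace S']

theorem measurable_transitionError : Measurable L.transitionError := by
  have hψ : Measurable fun x : S × A' => (x.1, L.ψ x) := measurable_fst.prodMk L.measurable_ψ
  have hφ : Measurable fun x : S × A' => (L.φ x.1, x.2) :=
    (L.measurable_φ.comp measurable_fst).prodMk measurable_snd
  convert measurable_totalVariation ((M.trans.comap _ hψ).map L.φ) (L.latent.trans.comap _ hφ)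
    using 2 with x
  rw [Kernel.map_apply _ L.measurable_φ, Kernel.comap_apply, Kernel.comap_apply]
  rfl

theorem totalVariation_chain_le [IsMarkovKernel pol] (s : S) :
    totalVariation ((M.chain (L.liftPolicy pol) s).map L.φ) (L.latent.chain pol (L.φ s)) ≤
      ∫⁻ a, L.transitionError (s, a) ∂(pol (L.φ s)) := by
  have hψ : Measurable fun a : A' => (s, L.ψ (s, a)) :=
    measurable_const.prodMk (L.measurable_ψ_right s)
  have hφ : Measurable fun a : A' => (L.φ s, a) := measurable_prodMk_left
  refine le_trans (le_of_eq ?_) (le_trans (totalVariation_lintegral_le (pol (L.φ s))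
    ((M.trans.comap _ hψ).map L.φ) (L.latent.trans.comap _ hφ)) (le_of_eq ?_))
  · refine tsum_congr fun z => ?_
    have hz := measurableSet_singleton z
    rw [Measure.map_apply L.measurable_φ hz, L.chain_liftPolicy_apply pol s (L.measurable_φ hz),
      L.latent.chain_apply pol _ hz]
    simp_rw [Kernel.map_apply' _ L.measurable_φ _ hz, Kernel.comap_apply]
  · simp_rw [Kernel.map_apply _ L.measurable_φ, Kernel.comap_apply]
    rfl

/-- The measurable total variation error carries the computation; the Wasserstein loss enters only
through this monotone bound, so its integrand need not be measurable. -/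
theorem lintegral_transitionError_le (μ : Measure (S × A')) :
    ∫⁻ x, L.transitionError x ∂μ ≤ L.localTransitionLoss discreteDist μ :=
  lintegral_mono fun _ => totalVariation_le_wasserstein _ _

/-- A one-step inequality for the latent chain bounds the bisimulation pseudometric by the
discounted losses along the chain and the discrete distance of the latent states. -/
theorem bisimDist_le_discountedSum [IsMarkovKernel pol] (γ : ℝ) (k : BisimKind) {ρ : S → ℝ≥0∞}
    (hρ : Measurable ρ) (c : ℝ≥0∞)
    (hk : ∀ s t e, M.rewardTerm (L.liftPolicy pol) γ s t k + max (ENNReal.ofReal γ * (c *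
        totalVariation (L.latent.chain pol (L.φ s)) (L.latent.chain pol (L.φ t))) + e)
        (M.labelTerm s t k) ≤ ρ s + ρ t + e + c * discreteDist (L.φ s) (L.φ t)) (s t : S) :
    M.bisimDist (L.liftPolicy pol) γ k s t ≤
      discountedSum (M.chain (L.liftPolicy pol)) (ENNReal.ofReal γ)
        (fun s => ρ s + ENNReal.ofReal γ * (c * ∫⁻ a, L.transitionError (s, a) ∂(pol (L.φ s)))) s +
      discountedSum (M.chain (L.liftPolicy pol)) (ENNReal.ofReal γ)
        (fun s => ρ s + ENNReal.ofReal γ * (c * ∫⁻ a, L.transitionError (s, a) ∂(pol (L.φ s)))) t +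
      c * discreteDist (L.φ s) (L.φ t) := by
  have hch := M.isMarkovKernel_chain _ (L.isMarkovKernel_liftPolicy pol)
  have hch' := L.latent.isMarkovKernel_chain pol inferInstance
  set τ : S → ℝ≥0∞ := fun s => ∫⁻ a, L.transitionError (s, a) ∂(pol (L.φ s)) with hτ
  have hτm : Measurable τ := L.measurable_lintegral_policy pol L.measurable_transitionError
  set g : S → ℝ≥0∞ := fun s => ρ s + ENNReal.ofReal γ * (c * τ s) with hg
  have hgm : Measurable g := hρ.add ((hτm.const_mul c).const_mul _)
  set f := discountedSum (M.chain (L.liftPolicy pol)) (ENNReal.ofReal γ) g with hf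
  have hfm : Measurable f := measurable_discountedSum _ _ hgm
  have hfix : ∀ s, f s = g s + ENNReal.ofReal γ * ∫⁻ t, f t ∂(M.chain (L.liftPolicy pol) s) :=
    discountedSum_eq _ _ hgm
  -- It suffices that this function is a supersolution of the bisimulation operator.
  refine OrderHom.lfp_le (f := M.bisimOp (L.liftPolicy pol) γ k)
    (a := fun s t => f s + f t + c * discreteDist (L.φ s) (L.φ t)) ?_ s t
  intro s t
  have htv : totalVariation ((M.chain (L.liftPolicy pol) s).map L.φ)
      ((M.chain (L.liftPolicy pol) t).map L.φ) ≤ τ s + totalVariation (L.latent.chain pol (L.φ s))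
        (L.latent.chain pol (L.φ t)) + τ t := by
    have : IsProbabilityMeasure ((M.chain (L.liftPolicy pol) t).map L.φ) :=
      Measure.isProbabilityMeasure_map L.measurable_φ.aemeasurable
    refine (totalVariation_triangle _ (L.latent.chain pol (L.φ t)) _).trans ?_
    rw [totalVariation_comm (L.latent.chain pol (L.φ t))]
    exact add_le_add ((totalVariation_triangle _ (L.latent.chain pol (L.φ s)) _).trans
      (add_le_add_left (L.totalVariation_chain_le pol s) _)) (L.totalVariation_chain_le pol t)
  have hW := (wasserstein_le_lintegral_add_totalVariation (M.chain (L.liftPolicy pol) s)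
    (M.chain (L.liftPolicy pol) t) L.measurable_φ hfm c).trans
    (add_le_add_right (mul_le_mul_right htv c) _)
  change M.rewardTerm (L.liftPolicy pol) γ s t k + max (ENNReal.ofReal γ * wasserstein
    (fun s t => f s + f t + c * discreteDist (L.φ s) (L.φ t)) _ _) (M.labelTerm s t k) ≤
    f s + f t + c * discreteDist (L.φ s) (L.φ t)
  -- The free term `e` of `hk` is taken to be `γ` times the integrals of `f` and the two transition
  -- errors; `hfix` then recombines `ρ` and `e` into `f s + f t`.
  refine (add_le_add_right (max_le_max ((mul_le_mul_right hW _).trans (le_of_eq ?_)) le_rfl)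
    _).trans ((hk s t (ENNReal.ofReal γ * (∫⁻ x, f x ∂(M.chain (L.liftPolicy pol) s) +
      ∫⁻ x, f x ∂(M.chain (L.liftPolicy pol) t) + c * (τ s + τ t)))).trans (le_of_eq ?_))
  · ring
  · rw [hfix s, hfix t]
    simp only [hg]
    ring

theorem bisimDist_le_of_stationary [MeasurableSingletonClass S] [IsMarkovKernel pol] (γ : ℝ)
    (k : BisimKind) {ρ : S → ℝ≥0∞} (hρ : Measurable ρ) (c : ℝ≥0∞)
    (hk : ∀ s t e, M.rewardTerm (L.liftPolicy pol) γ s t k + max (ENNReal.ofReal γ * (c *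
        totalVariation (L.latent.chain pol (L.φ s)) (L.latent.chain pol (L.φ t))) + e)
        (M.labelTerm s t k) ≤ ρ s + ρ t + e + c * discreteDist (L.φ s) (L.φ t))
    (ξ : Measure S) [IsProbabilityMeasure ξ] (hξ : (M.chain (L.liftPolicy pol)).Invariant ξ)
    {s₁ s₂ : S} (h₁ : ξ {s₁} ≠ 0) (h₂ : ξ {s₂} ≠ 0) (hφ : L.φ s₁ = L.φ s₂) :
    M.bisimDist (L.liftPolicy pol) γ k s₁ s₂ ≤ (1 - ENNReal.ofReal γ)⁻¹ *
      (∫⁻ s, ρ s ∂ξ + ENNReal.ofReal γ *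
        (c * L.localTransitionLoss discreteDist (L.stateAction pol ξ))) *
      ((ξ {s₁})⁻¹ + (ξ {s₂})⁻¹) := by
  have hτm := L.measurable_lintegral_policy pol L.measurable_transitionError
  have hg : Measurable fun s => ρ s + ENNReal.ofReal γ *
      (c * ∫⁻ a, L.transitionError (s, a) ∂(pol (L.φ s))) :=
    hρ.add ((hτm.const_mul c).const_mul _)
  have h := L.bisimDist_le_discountedSum pol γ k hρ c hk s₁ s₂
  rw [hφ, show discreteDist (L.φ s₂) (L.φ s₂) = 0 by simp [discreteDist], mul_zero,
    add_zero] at h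
  refine (h.trans (add_le_add (le_lintegral_mul_inv_measure_singleton ξ _ h₁)
    (le_lintegral_mul_inv_measure_singleton ξ _ h₂))).trans ?_
  rw [← mul_add, lintegral_discountedSum _ _ hg hξ, lintegral_add_left hρ,
    lintegral_const_mul _ (hτm.const_mul c), lintegral_const_mul _ hτm,
    L.lintegral_stateAction pol ξ L.measurable_transitionError]
  gcongr
  exact L.lintegral_transitionError_le _

end LatentSpaceModel

/-! ### The two bounds -/

theorem discreteDist_eq_zero_or_one {Y : Type*} (x y : Y) :
    (x = y ∧ discreteDist x y = 0) ∨ (x ≠ y ∧ discreteDist x y = 1) := by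
  by_cases h : x = y <;> simp [discreteDist, h]

theorem mainTheorem4 {S A AP S' A' : Type*}
    [MeasurableSpace S] [StandardBorelSpace S] [MeasurableSpace A] [StandardBorelSpace A]
    [MeasurableSpace S'] [Countable S'] [DiscreteMeasurableSpace S']
    [MeasurableSpace A'] [StandardBorelSpace A']
    (M : MDP S A AP) (L : LatentSpaceModel M S' A')
    (hreward : ∀ s a, M.reward (s, a) ∈ Set.Icc (-(1 / 2) : ℝ) (1 / 2))
    (hlabel : ∀ s, M.label s = L.latent.label (L.φ s))
    (γ : ℝ) (hγ0 : 0 ≤ γ) (hγ1 : γ < 1)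
    (pol : Kernel S' A') (hpol : L.latent.IsPolicy pol)
    (KR KP : ℝ) (hKR : 0 ≤ KR) (hKP : 0 ≤ KP) (hγKP : γ * KP < 1)
    (hLip : L.IsLipschitz discreteDist pol KR KP)
    (ξ : Measure S) [IsProbabilityMeasure ξ] (hξ : (M.chain (L.liftPolicy pol)).Invariant ξ)
    (s₁ s₂ : S) (hpos : M.IsErgodic ∨ (ξ {s₁} ≠ 0 ∧ ξ {s₂} ≠ 0))
    (hφ : L.φ s₁ = L.φ s₂) :
    M.bisimDist (L.liftPolicy pol) γ .reward s₁ s₂ ≤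
        (L.localRewardLoss (L.stateAction pol ξ) +
          ENNReal.ofReal γ * L.localTransitionLoss discreteDist (L.stateAction pol ξ) *
            ENNReal.ofReal KR / ENNReal.ofReal (1 - γ * KP)) *
          ((ξ {s₁})⁻¹ + (ξ {s₂})⁻¹) ∧
    M.bisimDist (L.liftPolicy pol) γ .label s₁ s₂ ≤
        ENNReal.ofReal γ * L.localTransitionLoss discreteDist (L.stateAction pol ξ) /
          ENNReal.ofReal (1 - γ) * ((ξ {s₁})⁻¹ + (ξ {s₂})⁻¹) := by
  have hmk := hpol.1
  have hch' := L.latent.isMarkovKernel_chain pol hmk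
  have hpos' : ξ {s₁} ≠ 0 ∧ ξ {s₂} ≠ 0 := by
    rcases hpos with he | h
    · have hreach := (he _ (L.isPolicy_liftPolicy pol hpol)).1
      exact ⟨measure_singleton_ne_zero_of_reachable hξ fun t => hreach t s₁,
        measure_singleton_ne_zero_of_reachable hξ fun t => hreach t s₂⟩
    · exact h
  have hG : 1 - ENNReal.ofReal γ = ENNReal.ofReal (1 - γ) := by
    rw [ENNReal.ofReal_sub _ hγ0, ENNReal.ofReal_one]
  have hg0 : ENNReal.ofReal (1 - γ) ≠ 0 := by simpa using hγ1
  constructor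
  -- The solution of `c = (1 - γ) K_R + γ K_P c`: the discrete term must pay for the latent reward
  -- gap and for its own propagation by one step.
  · set c : ℝ≥0∞ := ENNReal.ofReal (1 - γ) * (ENNReal.ofReal KR / ENNReal.ofReal (1 - γ * KP))
      with hc
    have hc' : c = ENNReal.ofReal (1 - γ) * ENNReal.ofReal KR +
        ENNReal.ofReal γ * (c * ENNReal.ofReal KP) := by
      have h1 : 0 < 1 - γ * KP := by linarith
      have h2 : 0 ≤ 1 - γ := by linarith
      have h3 : 0 ≤ KR / (1 - γ * KP) := by positivity
      rw [hc, ← ENNReal.ofReal_div_of_pos h1, ← ENNReal.ofReal_mul h2, ← ENNReal.ofReal_mul h2,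
        ← ENNReal.ofReal_mul (by positivity), ← ENNReal.ofReal_mul hγ0,
        ← ENNReal.ofReal_add (by positivity) (by positivity)]
      congr 1
      field_simp
      ring
    set r : S → ℝ≥0∞ := fun s => ∫⁻ a, L.rewardError (s, a) ∂(pol (L.φ s)) with hr
    have hrm : Measurable r := L.measurable_lintegral_policy pol L.measurable_rewardError
    have hrs := L.ofReal_abs_policyReward_sub_le pol fun s a => abs_le.2 (hreward s a)
    have h := L.bisimDist_le_of_stationary pol γ .reward (hrm.const_mul (ENNReal.ofReal (1 - γ))) c
      (fun s t e => ?_) ξ hξ hpos'.1 hpos'.2 hφ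
    · refine h.trans (le_of_eq ?_)
      -- Both `ρ` and `c` carry a factor `1 - γ`, which cancels the sum of the geometric series.
      rw [lintegral_const_mul _ hrm, L.lintegral_stateAction pol ξ L.measurable_rewardError, hG, hc,
        show ∀ a b d x k : ℝ≥0∞, d⁻¹ * (d * a + x * (d * k * b)) = d⁻¹ * d * (a + x * b * k) by
          intros; ring, ENNReal.inv_mul_cancel hg0 ENNReal.ofReal_ne_top, one_mul, mul_div_assoc]
      rfl
    · have hrew : ENNReal.ofReal |M.policyReward (L.liftPolicy pol) s -
          M.policyReward (L.liftPolicy pol) t| ≤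
          r s + r t + ENNReal.ofReal KR * discreteDist (L.φ s) (L.φ t) := by
        refine le_trans ?_ (add_le_add (add_le_add (hrs s) (hrs t)) (hLip (L.φ s) (L.φ t)).1)
        rw [← ENNReal.ofReal_add (abs_nonneg _) (abs_nonneg _),
          ← ENNReal.ofReal_add (by positivity) (abs_nonneg _)]
        refine ENNReal.ofReal_le_ofReal ?_
        have e1 := abs_sub_le (M.policyReward (L.liftPolicy pol) s)
          (L.latent.policyReward pol (L.φ s)) (M.policyReward (L.liftPolicy pol) t)
        have e2 := abs_sub_le (L.latent.policyReward pol (L.φ s))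
          (L.latent.policyReward pol (L.φ t)) (M.policyReward (L.liftPolicy pol) t)
        have e3 := abs_sub_comm (L.latent.policyReward pol (L.φ t))
          (M.policyReward (L.liftPolicy pol) t)
        linarith
      have htv := (totalVariation_le_wasserstein _ _).trans (hLip (L.φ s) (L.φ t)).2
      change ENNReal.ofReal ((1 - γ) * _) + max _ 0 ≤ _
      rw [ENNReal.ofReal_mul (by linarith), max_eq_left zero_le]
      calc _ ≤ ENNReal.ofReal (1 - γ) *
              (r s + r t + ENNReal.ofReal KR * discreteDist (L.φ s) (L.φ t)) +
            (ENNReal.ofReal γ * (c * (ENNReal.ofReal KP * discreteDist (L.φ s) (L.φ t))) + e) := by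
            gcongr
        _ = ENNReal.ofReal (1 - γ) * r s + ENNReal.ofReal (1 - γ) * r t + e +
            (ENNReal.ofReal (1 - γ) * ENNReal.ofReal KR + ENNReal.ofReal γ *
              (c * ENNReal.ofReal KP)) * discreteDist (L.φ s) (L.φ t) := by ring
        _ = _ := by rw [← hc']
  -- Here `ρ = 0` and `c = 1`. States with equal images have equal labels and equal latent laws;
  -- otherwise the discrete term is `1` and dominates both the label term and `γ` times the total
  -- variation.
  · have h := L.bisimDist_le_of_stationary pol γ .label (ρ := fun _ => 0) measurable_const 1
      (fun s t e => ?_) ξ hξ hpos'.1 hpos'.2 hφ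
    · refine h.trans (le_of_eq ?_)
      rw [lintegral_zero, zero_add, one_mul, hG, div_eq_mul_inv]
      ring
    · change 0 + max _ (discreteDist (M.label s) (M.label t)) ≤ _
      rw [zero_add, zero_add, zero_add, one_mul, one_mul, hlabel s, hlabel t]
      rcases discreteDist_eq_zero_or_one (L.φ s) (L.φ t) with ⟨hst, hd⟩ | ⟨-, hd⟩
      · rw [hd, hst]
        simp [discreteDist]
      · rw [hd, add_comm e]
        refine max_le (add_le_add_left ?_ e) (le_trans ?_ le_self_add)
        · exact mul_le_one' (by simpa using hγ1.le) (totalVariation_le_one _ _)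
        · unfold discreteDist
          split_ifs <;> simp
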